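/- Let $G=\mathbb{Z}_2^n$, and say that $A\subseteq G$ affinely generates $G$ if the smallest coset (of any subgroup of $G$) containing $A$ is $G$ itself. Suppose $A,B\subseteq G$ are such that $A$ affinely generates $G$, $B\neq\varnothing$ and $|A|\le\frac34|G|$. If $t$ is the largest positive integer such that $$|A|\le\frac{t+1}{2^t}\cdot|G|,$$ and the integer $0\le k<t$ and the real number $w\in[-1,1]$ are such that $$|B|=\frac{\binom t0+\binom t1+\dots+\binom tk+w\binom{t-1}{k}}{2^t}\cdot|G|,$$ then $$|A+B|\ge\frac{\binom t0+\binom t1+\dots+\binom tk+\binom t{k+1}+w\binom{t-1}{k+1}}{2^t}\cdot|G|.$$ The bound is tight when $w=0$: let $D_k^t=\{x\in\mathbb{Z}_2^t : \#\{i : x_i=1\}\le k\}$ be the Hamming ball of radius $k$ in $\mathbb{Z}_2^t$. For all integers $2\le t\le n$ and $0\le k<t$, the sets $$A=D_1^t\times\mathbb{Z}_2^{n-t},\qquad B=D_k^t\times\mathbb{Z}_2^{n-t}$$ satisfy all the hypotheses above with this $t$, this $k$ and $w=0$; moreover $A+B=D_{k+1}^t\times\mathbb{Z}_2^{n-t}$,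 and the lower bound on $|A+B|$ holds with equality. -/

import Mathlib

open Finset
open scoped Pointwise

/-- The Hamming ball of radius `k` in `ℤ₂ᵗ`: the vectors with at most `k` coordinates equal to 1. -/
def hammingBall (t k : ℕ) : Finset (Fin t → ZMod 2) :=
  {x | #{i | x i = 1} ≤ k}

/-- The product of the Hamming ball of radius `k` in `ℤ₂ᵗ` with `ℤ₂ⁿ⁻ᵗ`, as a subset of `ℤ₂ⁿ`:
the vectors whose first `t` coordinates form an element of the ball. -/
def hammingBallProd {n t : ℕ} (h : t ≤ n) (k : ℕ) : Finset (Fin n → ZMod 2) :=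
  {x | (fun i : Fin t => x (Fin.castLE h i)) ∈ hammingBall t k}

/-! Put `s = t - 1` and write φ_s for `ballProfile s`. By Pascal's rule the lower bound becomes
φ_s(2^s|B|/|G|) ≤ 2^s|A+B|/|G|; maximality of `t` enters only as |A| > (s+3)/2^(s+2)·|G|.

This is proved by induction on `s` in `ballProfile_le_card_add`. An affine change of coordinates
puts 0 and the standard basis into A. Split everything by the first coordinate. Compressions
(`exists_compressed`) preserve the sizes and the sumset inclusions, and reach A₁ + A₀ ⊆ A₀. Then A₀
is a union of cosets of the span of A₁, and counting these cosets (`card_lower_half_lt`) shows that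
A₀ is dense enough for the previous value of `s`.

The induction hypothesis bounds A₀ + B₀ and A₀ + B₁ from below, and 0 ∈ A₁ gives |A₁ + B₀| ≥ |B₀|.
The concavity inequality `ballProfile_succ_add_le` combines these bounds into the one for φ_(s+1).
-/

/-- The size of the Hamming ball of radius `k - 1` in dimension `s`, as a real number. -/
noncomputable def binomSum (s k : ℕ) : ℝ := ∑ i ∈ range k, (s.choose i : ℝ)

/-- The line through `(binomSum s j, binomSum s (j + 1))` and
`(binomSum s (j + 1), binomSum s (j + 2))`. -/
noncomputable def ballLine (s j : ℕ) (x : ℝ) : ℝ :=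
  binomSum s (j + 1) + ((s : ℝ) - j) / (j + 1) * (x - binomSum s j)

/-- The concave piecewise linear function taking the size of each Hamming ball in dimension `s`
to the size of the ball whose radius is larger by one. -/
noncomputable def ballProfile (s : ℕ) (x : ℝ) : ℝ :=
  (range (s + 1)).inf' nonempty_range_add_one fun j => ballLine s j x

/-! ### The ball profile: interpolation, concavity and the two-halves inequality. -/

theorem binomSum_zero (s : ℕ) : binomSum s 0 = 0 := by simp [binomSum]

theorem binomSum_succ (s k : ℕ) : binomSum s (k + 1) = binomSum s k + s.choose k := by
  simp [binomSum, sum_range_succ]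

theorem binomSum_succ_succ (s k : ℕ) :
    binomSum (s + 1) (k + 1) = binomSum s (k + 1) + binomSum s k := by
  induction k with
  | zero => simp [binomSum]
  | succ k ih =>
    rw [binomSum_succ, ih, binomSum_succ s (k + 1), binomSum_succ s k, Nat.choose_succ_succ]
    push_cast
    ring

theorem binomSum_nonneg (s k : ℕ) : 0 ≤ binomSum s k := by
  unfold binomSum; positivity

theorem binomSum_of_lt {s k : ℕ} (h : s < k) : binomSum s k = 2 ^ s := by
  induction k with
  | zero => omega
  | succ k ih =>
    rcases Nat.lt_or_ge s k with h' | h'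
    · rw [binomSum_succ, ih h', Nat.choose_eq_zero_of_lt h']; simp
    · obtain rfl : s = k := by omega
      unfold binomSum
      exact_mod_cast Nat.sum_range_choose s

theorem slope_mul_choose (s j : ℕ) :
    ((s : ℝ) - j) / (j + 1) * s.choose j = s.choose (j + 1) := by
  have h1 : (0 : ℝ) < j + 1 := by positivity
  rw [div_mul_eq_mul_div, div_eq_iff h1.ne']
  rcases le_or_gt j s with h | h
  · have := Nat.choose_succ_right_eq s j
    have h2 : ((s.choose (j + 1) * (j + 1) : ℕ) : ℝ) = ((s.choose j * (s - j) : ℕ) : ℝ) := by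
      rw [this]
    push_cast [Nat.cast_sub h] at h2
    linarith
  · rw [Nat.choose_eq_zero_of_lt h, Nat.choose_eq_zero_of_lt (by omega)]
    simp

theorem slope_antitone (s : ℕ) {j k : ℕ} (h : j ≤ k) :
    ((s : ℝ) - k) / (k + 1) ≤ ((s : ℝ) - j) / (j + 1) := by
  have hj : (0 : ℝ) < j + 1 := by positivity
  have hk : (0 : ℝ) < k + 1 := by positivity
  have h' : (j : ℝ) ≤ k := by exact_mod_cast h
  have hs : (0 : ℝ) ≤ s := by positivity
  rw [div_le_div_iff₀ hk hj]
  nlinarith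

theorem ballLine_self (s k : ℕ) (l : ℝ) :
    ballLine s k (binomSum s k + l * s.choose k) =
      binomSum s (k + 1) + l * s.choose (k + 1) := by
  rw [ballLine, ← slope_mul_choose]
  ring

/-- The slopes (s-j)/(j+1) are ratios of consecutive binomial coefficients and decrease in `j`, so
the broken line through these points is concave and lies below each extended segment. -/
theorem binomSum_le_ballLine (s j k : ℕ) : binomSum s (k + 1) ≤ ballLine s j (binomSum s k) := by
  rcases le_total j k with h | h
  · induction k, h using Nat.le_induction with
    | base => simp [ballLine]
    | succ k hk ih =>
      have h1 := mul_le_mul_of_nonneg_right (slope_antitone s hk) (Nat.cast_nonneg (s.choose k))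
      rw [slope_mul_choose] at h1
      rw [binomSum_succ s (k + 1)]
      simp only [ballLine] at ih ⊢
      rw [binomSum_succ s k] at ih ⊢
      linarith
  · obtain ⟨d, hd⟩ := Nat.exists_eq_add_of_le h
    clear h
    induction d generalizing k with
    | zero => obtain rfl : j = k := hd; simp [ballLine]
    | succ d ih =>
      have ih := ih (k + 1) (by omega)
      have h1 := mul_le_mul_of_nonneg_right (slope_antitone s (show k ≤ j by omega))
        (Nat.cast_nonneg (α := ℝ) (s.choose k))
      rw [slope_mul_choose] at h1
      rw [binomSum_succ s (k + 1)] at ih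
      simp only [ballLine] at ih ⊢
      rw [binomSum_succ s k] at ih ⊢
      linarith

theorem ballProfile_le_ballLine {s j : ℕ} (h : j ≤ s) (x : ℝ) :
    ballProfile s x ≤ ballLine s j x :=
  inf'_le _ (mem_range.2 (by omega))

theorem ballProfile_le_two_pow (s : ℕ) (x : ℝ) : ballProfile s x ≤ 2 ^ s := by
  refine (ballProfile_le_ballLine le_rfl x).trans ?_
  simp [ballLine, binomSum_of_lt]

theorem ballProfile_eq (s k : ℕ) {l : ℝ} (h0 : 0 ≤ l) (h1 : l ≤ 1) :
    ballProfile s (binomSum s k + l * s.choose k) =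
      binomSum s (k + 1) + l * s.choose (k + 1) := by
  refine le_antisymm ?_ ?_
  · rcases le_or_gt k s with h | h
    · exact (ballProfile_le_ballLine h _).trans_eq (ballLine_self s k l)
    · refine (ballProfile_le_two_pow s _).trans_eq ?_
      rw [binomSum_of_lt (by omega), Nat.choose_eq_zero_of_lt (by omega)]
      simp
  · refine le_inf' _ _ fun j _ => ?_
    have e1 := mul_le_mul_of_nonneg_left (binomSum_le_ballLine s j k) (sub_nonneg.2 h1)
    have e2 := mul_le_mul_of_nonneg_left (binomSum_le_ballLine s j (k + 1)) h0
    have e3 : ballLine s j (binomSum s k + l * s.choose k) =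
        (1 - l) * ballLine s j (binomSum s k) + l * ballLine s j (binomSum s (k + 1)) := by
      simp only [ballLine, binomSum_succ s k]
      ring
    rw [e3]
    rw [binomSum_succ s (k + 1)] at e2
    linarith

theorem ballProfile_mono (s : ℕ) : Monotone (ballProfile s) := by
  intro x y hxy
  refine le_inf' _ _ fun j hj =>
    (ballProfile_le_ballLine (by simpa [Nat.lt_succ_iff] using hj) x).trans ?_
  have hj' : (j : ℝ) ≤ s := by exact_mod_cast (by simpa [Nat.lt_succ_iff] using hj : j ≤ s)
  unfold ballLine
  have : 0 ≤ ((s : ℝ) - j) / (j + 1) := div_nonneg (by linarith) (by positivity)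
  gcongr

theorem ballProfile_concaveOn (s : ℕ) : ConcaveOn ℝ Set.univ (ballProfile s) := by
  refine ⟨convex_univ, fun x _ y _ a b ha hb hab => ?_⟩
  refine le_inf' _ _ fun j hj => ?_
  have hj' : j ≤ s := by simpa [Nat.lt_succ_iff] using hj
  have e1 := mul_le_mul_of_nonneg_left (ballProfile_le_ballLine hj' x) ha
  have e2 := mul_le_mul_of_nonneg_left (ballProfile_le_ballLine hj' y) hb
  have e3 : ballLine s j (a • x + b • y) = a * ballLine s j x + b * ballLine s j y := by
    obtain rfl : b = 1 - a := by linarith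
    simp only [ballLine, smul_eq_mul]
    ring
  rw [e3]
  simpa using add_le_add e1 e2

/-- For a concave function, the sum of the values at the ends of an interval is at most the sum
at any two inner points with the same midpoint. -/
theorem ConcaveOn.add_le_add_of_add_eq {f : ℝ → ℝ} (hf : ConcaveOn ℝ Set.univ f)
    {x₀ x₁ z₀ z₁ : ℝ} (h : x₀ + x₁ = z₀ + z₁) (h0 : x₀ < z₀) (h1 : x₁ ≤ x₀) :
    f z₀ + f z₁ ≤ f x₀ + f x₁ := by
  have hz : 0 < z₀ - z₁ := by linarith
  have hl : 0 ≤ (x₀ - z₁) / (z₀ - z₁) := div_nonneg (by linarith) hz.le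
  have hl' : 0 ≤ (z₀ - x₀) / (z₀ - z₁) := div_nonneg (by linarith) hz.le
  have hs : (x₀ - z₁) / (z₀ - z₁) + (z₀ - x₀) / (z₀ - z₁) = 1 := by field_simp; ring
  have c0 := hf.2 (Set.mem_univ z₀) (Set.mem_univ z₁) hl hl' hs
  have c1 := hf.2 (Set.mem_univ z₁) (Set.mem_univ z₀) hl hl' hs
  have e0 : (x₀ - z₁) / (z₀ - z₁) * z₀ + (z₀ - x₀) / (z₀ - z₁) * z₁ = x₀ := by
    field_simp; ring
  have e1 : (x₀ - z₁) / (z₀ - z₁) * z₁ + (z₀ - x₀) / (z₀ - z₁) * z₀ = x₁ := by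
    obtain rfl : x₁ = z₀ + z₁ - x₀ := by linarith
    field_simp; ring
  simp only [smul_eq_mul] at c0 c1
  rw [e0] at c0
  rw [e1] at c1
  have e2 : (x₀ - z₁) / (z₀ - z₁) = 1 - (z₀ - x₀) / (z₀ - z₁) := by linarith
  rw [e2] at c0 c1
  linarith

theorem exists_eq_binomSum_add (s : ℕ) {x : ℝ} (h0 : 0 ≤ x) (h1 : x ≤ 2 ^ s) :
    ∃ k ≤ s, ∃ l : ℝ, 0 ≤ l ∧ l ≤ 1 ∧ x = binomSum s k + l * s.choose k := by
  classical
  have hex : ∃ k, x ≤ binomSum s (k + 1) := ⟨s, by rwa [binomSum_of_lt (by omega)]⟩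
  set k := Nat.find hex with hk
  have hks : k ≤ s := Nat.find_min' hex (by rwa [binomSum_of_lt (by omega)])
  have hle : x ≤ binomSum s (k + 1) := Nat.find_spec hex
  have hge : binomSum s k ≤ x := by
    rcases Nat.eq_zero_or_pos k with h | h
    · rw [h, binomSum_zero]; exact h0
    · have := Nat.find_min hex (m := k - 1) (by omega)
      rw [Nat.sub_add_cancel h] at this
      exact (not_le.1 this).le
  have hc : (0 : ℝ) < s.choose k := by exact_mod_cast Nat.choose_pos hks
  rw [binomSum_succ] at hle
  refine ⟨k, hks, (x - binomSum s k) / s.choose k, div_nonneg (by linarith) hc.le, ?_, ?_⟩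
  · rw [div_le_one hc]; linarith
  · field_simp; ring

/-- Models slicing a Hamming ball: the halves of a ball in dimension s+1 are balls in dimension s of
consecutive radii, of sizes z₀ and z₁. Interpolated sizes split in the same way. -/
theorem exists_balanced (s : ℕ) {x : ℝ} (h0 : 0 ≤ x) (h1 : x ≤ 2 ^ (s + 1)) :
    ∃ z₀ z₁ : ℝ, 0 ≤ z₁ ∧ x = z₀ + z₁ ∧ z₀ ≤ ballProfile s z₁ ∧
      ballProfile (s + 1) x = z₀ + ballProfile s z₀ := by
  obtain ⟨k, hk, l, hl0, hl1, rfl⟩ := exists_eq_binomSum_add (s + 1) h0 h1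
  rw [ballProfile_eq _ _ hl0 hl1]
  have hp0 := fun k => ballProfile_eq s k hl0 hl1
  cases k with
  | zero =>
    have h2 := ballProfile_eq s 0 le_rfl zero_le_one
    have h3 := hp0 0
    simp only [binomSum_zero, binomSum_succ, Nat.choose_zero_right, Nat.cast_one, zero_add,
      mul_one, zero_mul, add_zero, Nat.choose_one_right] at h2 h3 ⊢
    -- The profile is 1 at 0, so here z₀ = l may be smaller than the profile at z₁; this is why only
    -- an inequality is claimed.
    refine ⟨l, 0, le_rfl, by ring, by rw [h2]; exact hl1, ?_⟩
    rw [h3]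
    push_cast
    ring
  | succ k =>
    refine ⟨_, _, ?_, ?_, (hp0 k).ge, ?_⟩
    · have := binomSum_nonneg s k
      positivity
    · rw [binomSum_succ_succ, Nat.choose_succ_succ]
      push_cast
      ring
    · rw [hp0, binomSum_succ_succ, Nat.choose_succ_succ s (k + 1)]
      push_cast
      ring

/-- Compare with the balanced splitting x₀ + x₁ = z₀ + z₁. If z₀ ≤ x₀, monotonicity and y₁ ≥ x₀
suffice; otherwise x₀, x₁ lie between z₁ and z₀ and concavity applies. The bound at x₁ is asked only
for x₁ ≠ 0, since the profile is 1 at 0 while an empty half has an empty sumset. -/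
theorem ballProfile_succ_add_le (s : ℕ) {x₀ x₁ y₀ y₁ : ℝ} (h1 : 0 ≤ x₁) (h01 : x₁ ≤ x₀)
    (h0 : x₀ ≤ 2 ^ s) (hy0 : ballProfile s x₀ ≤ y₀) (hy1 : x₀ ≤ y₁)
    (hy1' : x₁ ≠ 0 → ballProfile s x₁ ≤ y₁) :
    ballProfile (s + 1) (x₀ + x₁) ≤ y₀ + y₁ := by
  obtain ⟨z₀, z₁, hz1, hx, hz, he⟩ :=
    exists_balanced s (x := x₀ + x₁) (by linarith) (by rw [pow_succ]; linarith)
  rw [he]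
  rcases le_or_gt z₀ x₀ with h | h
  · have := ballProfile_mono s h
    linarith
  · have := (ballProfile_concaveOn s).add_le_add_of_add_eq hx h h01
    -- Nonzero because x₁ = z₀ + z₁ - x₀ > z₁ ≥ 0.
    have := hy1' (by linarith)
    linarith

/-! ### Compressions, and the density of the lower half. -/

section Compression

variable {V : Type*} [AddCommGroup V] [Module (ZMod 2) V]

theorem add_self_of_zmod_two (x : V) : x + x = 0 := ZModModule.add_self x

theorem span_add_mem {A U : Finset V} (h : ∀ u ∈ U, ∀ a ∈ A, u + a ∈ A) {u : V}
    (hu : u ∈ Submodule.span (ZMod 2) (U : Set V)) : ∀ a ∈ A, u + a ∈ A := by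
  induction hu using Submodule.span_induction with
  | mem x hx => exact h x hx
  | zero => intro a ha; rwa [zero_add]
  | add x y _ _ hx hy => intro a ha; rw [add_assoc]; exact hx _ (hy a ha)
  | smul c x _ hx =>
    intro a ha
    obtain rfl | rfl : c = 0 ∨ c = 1 := by revert c; decide
    · rwa [zero_smul, zero_add]
    · rw [one_smul]; exact hx a ha

/-- A spanning set that contains `0` and is periodic modulo a subspace `K` has at least
`codim K + 1` cosets of `K`. -/
theorem codim_succ_mul_card_le [Fintype V] (K : Submodule (ZMod 2) V) (A : Finset V)
    (h0 : 0 ∈ A) (hspan : Submodule.span (ZMod 2) (A : Set V) = ⊤)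
    (hK : ∀ u ∈ K, ∀ a ∈ A, u + a ∈ A) :
    (Module.finrank (ZMod 2) (V ⧸ K) + 1) * Nat.card K ≤ #A := by
  have : Fintype K := Fintype.ofFinite K
  classical
  set S := A.image K.mkQ with hS
  have hcard : Nat.card K * #S ≤ #A := by
    refine mul_card_image_le_card A _ fun y hy => ?_
    obtain ⟨a, ha, rfl⟩ := mem_image.1 hy
    rw [Nat.card_eq_fintype_card, ← card_univ]
    refine card_le_card_of_injOn (fun u : K => (u : V) + a) (fun u _ => ?_)
      (fun u _ v _ h => Subtype.ext (add_right_cancel h))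
    simp only [coe_filter, Set.mem_ofPred_eq]
    refine ⟨hK u u.2 a ha, ?_⟩
    simp
  have h0S : (0 : V ⧸ K) ∈ S := mem_image.2 ⟨0, h0, map_zero _⟩
  -- The nonzero classes already span the quotient, so there are at least codim K of them; the zero
  -- class adds one.
  have hSspan : Submodule.span (ZMod 2) ((S.erase 0 : Finset (V ⧸ K)) : Set (V ⧸ K)) = ⊤ := by
    rw [coe_erase, Submodule.span_sdiff_singleton_zero, hS, coe_image, ← Submodule.map_span, hspan,
      Submodule.map_top, Submodule.range_mkQ]
  have hle := finrank_span_finset_le_card (R := ZMod 2) (S.erase 0)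
  rw [Set.finrank, hSspan, finrank_top, card_erase_of_mem h0S] at hle
  have hpos : 0 < #S := card_pos.2 ⟨_, h0S⟩
  calc _ ≤ #S * Nat.card K := Nat.mul_le_mul_right _ (by omega)
    _ ≤ #A := by rwa [mul_comm]

variable [DecidableEq V]

theorem card_union_add_card_inter_vadd (S T : Finset V) (u : V) :
    #(S ∪ (u +ᵥ T)) + #(T ∩ (u +ᵥ S)) = #S + #T := by
  have h : #(T ∩ (u +ᵥ S)) = #(S ∩ (u +ᵥ T)) := by
    rw [← card_vadd_finset u (T ∩ (u +ᵥ S)), vadd_finset_inter, vadd_vadd,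
      add_self_of_zmod_two, zero_vadd, inter_comm]
  rw [h, card_union_add_card_inter, card_vadd_finset]

theorem mem_vadd_finset_iff_add_mem {S : Finset V} {u x : V} : x ∈ u +ᵥ S ↔ u + x ∈ S := by
  rw [mem_vadd_finset]
  constructor
  · rintro ⟨y, hy, rfl⟩
    rwa [vadd_eq_add, ← add_assoc, add_self_of_zmod_two, zero_add]
  · intro h
    exact ⟨_, h, by rw [vadd_eq_add, ← add_assoc, add_self_of_zmod_two, zero_add]⟩

/-- Compression along the direction (1, u): in each pair {(0, x), (1, x + u)}, a single element
present is moved to the lower half. Since 2u = 0, the sumset inclusions survive. -/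
theorem compress_add_subset_zero (A₀ A₁ B₀ B₁ C₀ C₁ : Finset V) (u : V)
    (h00 : A₀ + B₀ ⊆ C₀) (h11 : A₁ + B₁ ⊆ C₀) (h01 : A₀ + B₁ ⊆ C₁) (h10 : A₁ + B₀ ⊆ C₁) :
    (A₀ ∪ (u +ᵥ A₁)) + (B₀ ∪ (u +ᵥ B₁)) ∪ (A₁ ∩ (u +ᵥ A₀) + B₁ ∩ (u +ᵥ B₀)) ⊆
      C₀ ∪ (u +ᵥ C₁) := by
  have hu := add_self_of_zmod_two u
  simp only [add_subset_iff] at h00 h11 h01 h10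
  simp only [union_subset_iff, add_subset_iff, mem_union, mem_inter, mem_vadd_finset_iff_add_mem]
  constructor
  · rintro a (ha | ha) b (hb | hb)
    · exact .inl (h00 a ha b hb)
    · exact .inr (by simpa [add_left_comm] using h01 a ha _ hb)
    · exact .inr (by simpa [add_assoc] using h10 _ ha _ hb)
    · left
      have := h11 _ ha _ hb
      rwa [add_add_add_comm, hu, zero_add] at this
  · rintro a ⟨ha, -⟩ b ⟨hb, -⟩
    exact .inl (h11 a ha b hb)

theorem compress_add_subset_one (A₀ A₁ B₀ B₁ C₀ C₁ : Finset V) (u : V)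
    (h00 : A₀ + B₀ ⊆ C₀) (h11 : A₁ + B₁ ⊆ C₀) (h01 : A₀ + B₁ ⊆ C₁) (h10 : A₁ + B₀ ⊆ C₁) :
    (A₀ ∪ (u +ᵥ A₁)) + (B₁ ∩ (u +ᵥ B₀)) ∪ (A₁ ∩ (u +ᵥ A₀) + (B₀ ∪ (u +ᵥ B₁))) ⊆
      C₁ ∩ (u +ᵥ C₀) := by
  have hu := add_self_of_zmod_two u
  simp only [add_subset_iff] at h00 h11 h01 h10
  simp only [union_subset_iff, add_subset_iff, mem_union, mem_inter, mem_vadd_finset_iff_add_mem]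
  constructor
  · rintro a (ha | ha) b ⟨hb, hb'⟩
    · exact ⟨h01 a ha b hb, by simpa [add_left_comm] using h00 a ha _ hb'⟩
    · refine ⟨?_, by simpa [add_assoc] using h11 _ ha _ hb⟩
      have := h10 _ ha _ hb'
      rwa [add_add_add_comm, hu, zero_add] at this
  · rintro a ⟨ha, ha'⟩ b (hb | hb)
    · exact ⟨h10 a ha b hb, by simpa [add_assoc] using h00 _ ha' _ hb⟩
    · refine ⟨?_, by simpa [add_left_comm] using h11 _ ha _ hb⟩
      have := h01 _ ha' _ hb
      rwa [add_add_add_comm, hu, zero_add] at this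

/-- Two halves of each of two sets can be compressed so that the sizes are kept, the sumset does
not grow, and the upper half of the first set maps its lower half into itself by addition. -/
theorem exists_compressed [Fintype V] (A₀ A₁ B₀ B₁ C₀ C₁ : Finset V) (h1 : 0 ∈ A₁)
    (h00 : A₀ + B₀ ⊆ C₀) (h11 : A₁ + B₁ ⊆ C₀) (h01 : A₀ + B₁ ⊆ C₁) (h10 : A₁ + B₀ ⊆ C₁) :
    ∃ A₀' A₁' B₀' B₁' C₀' C₁' : Finset V, A₀ ⊆ A₀' ∧ 0 ∈ A₁' ∧
      #A₀' + #A₁' = #A₀ + #A₁ ∧ #B₀' + #B₁' = #B₀ + #B₁ ∧ #C₀' + #C₁' = #C₀ + #C₁ ∧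
      A₀' + B₀' ⊆ C₀' ∧ A₁' + B₁' ⊆ C₀' ∧ A₀' + B₁' ⊆ C₁' ∧ A₁' + B₀' ⊆ C₁' ∧
      ∀ u ∈ A₁', ∀ a ∈ A₀', u + a ∈ A₀' := by
  induction hm : Fintype.card V - #A₀ using Nat.strong_induction_on
    generalizing A₀ A₁ B₀ B₁ C₀ C₁ with
  | _ m ih =>
  by_cases hc : ∀ u ∈ A₁, ∀ a ∈ A₀, u + a ∈ A₀
  · exact ⟨A₀, A₁, B₀, B₁, C₀, C₁, Subset.rfl, h1, rfl, rfl, rfl, h00, h11, h01, h10, hc⟩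
  · push Not at hc
    obtain ⟨x, hx, u, hu, hxu⟩ := hc
    have hs := compress_add_subset_zero A₀ A₁ B₀ B₁ C₀ C₁ u h00 h11 h01 h10
    have ht := compress_add_subset_one A₀ A₁ B₀ B₁ C₀ C₁ u h00 h11 h01 h10
    rw [union_subset_iff] at hs ht
    -- The lower half gains u + x, so the process terminates; u ∈ A₀ keeps 0 in the upper half.
    have hlt : #A₀ < #(A₀ ∪ (u +ᵥ A₁)) := by
      refine card_lt_card ⟨subset_union_left, fun h => hxu (h (mem_union_right _ ?_))⟩
      rw [mem_vadd_finset_iff_add_mem, add_left_comm, add_self_of_zmod_two, add_zero]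
      exact hx
    have hle := card_le_univ (A₀ ∪ (u +ᵥ A₁))
    have h1' : (0 : V) ∈ A₁ ∩ (u +ᵥ A₀) := by
      rw [mem_inter, mem_vadd_finset_iff_add_mem, add_zero]
      exact ⟨h1, hu⟩
    obtain ⟨A₀', A₁', B₀', B₁', C₀', C₁', e1, e2, e3, e4, e5, e6⟩ :=
      ih _ (by omega) _ _ _ _ _ _ h1' hs.1 hs.2 ht.1 ht.2 rfl
    rw [card_union_add_card_inter_vadd] at e3 e4 e5
    exact ⟨A₀', A₁', B₀', B₁', C₀', C₁', subset_union_left.trans e1, e2, e3, e4, e5, e6⟩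

/-- If the upper half `A₁` of a large set maps the spanning lower half `A₀` into itself, then `A₀`
is relatively larger than the whole set. -/
theorem card_lower_half_lt [Fintype V] (s : ℕ) (A₀ A₁ : Finset V)
    (h0 : 0 ∈ A₀) (hspan : Submodule.span (ZMod 2) (A₀ : Set V) = ⊤)
    (hA : ∀ u ∈ A₁, ∀ a ∈ A₀, u + a ∈ A₀)
    (hcard : (s + 4) * (2 * Fintype.card V) < (#A₀ + #A₁) * 2 ^ (s + 3)) :
    (s + 3) * Fintype.card V < #A₀ * 2 ^ (s + 2) ∧ (s = 0 → A₀ = univ) := by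
  set K := Submodule.span (ZMod 2) (A₁ : Set V) with hKdef
  have hK : ∀ u ∈ K, ∀ a ∈ A₀, u + a ∈ A₀ := fun u hu => span_add_mem hA hu
  have hA0 := codim_succ_mul_card_le K A₀ h0 hspan hK
  have hV := K.card_eq_card_quotient_mul_card
  rw [Module.natCard_eq_pow_finrank (K := ZMod 2) (V := V ⧸ K), Nat.card_zmod,
    Nat.card_eq_fintype_card] at hV
  have : Fintype K := Fintype.ofFinite K
  have hA1 : #A₁ ≤ Nat.card K := by
    rw [Nat.card_eq_fintype_card, ← Fintype.card_coe]
    exact Fintype.card_le_of_injective (fun x : A₁ => (⟨x, Submodule.subset_span x.2⟩ : K))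
      fun x y h => Subtype.ext (congrArg (fun z : K => (z : V)) h)
  have hKpos : 0 < Nat.card K := Nat.card_pos
  generalize Module.finrank (ZMod 2) (V ⧸ K) = m at *
  generalize Nat.card K = c at *
  refine ⟨?_, ?_⟩
  -- If the codimension m is at least s+2, then A₁ has density at most 1/2^(s+2), and A₀ has the
  -- rest. If m ≤ s+1, the coset count gives A₀ density at least (m+1)/2^m > (s+3)/2^(s+2).
  · rcases Nat.lt_or_ge (s + 1) m with hm | hm
    · obtain ⟨r, rfl⟩ := Nat.exists_eq_add_of_le (show s + 2 ≤ m by omega)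
      have h2 : c * 2 ^ (s + 2) ≤ Fintype.card V := by
        rw [hV, pow_add 2 (s + 2) r]
        exact Nat.mul_le_mul_left _ (Nat.le_mul_of_pos_right _ (by positivity))
      have h3 := Nat.mul_le_mul_right (2 ^ (s + 2)) hA1
      rw [pow_succ 2 (s + 2)] at hcard
      nlinarith
    · obtain ⟨r, hr⟩ := Nat.exists_eq_add_of_le hm
      have h2 : r + 1 ≤ 2 ^ r := Nat.lt_two_pow_self
      have h3 := Nat.mul_le_mul_right (2 ^ (s + 2)) hA0
      have h4 : s + 3 < (m + 1) * (2 ^ r * 2) := by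
        have : (m + 1) * ((r + 1) * 2) ≤ (m + 1) * (2 ^ r * 2) := by gcongr
        have : 0 ≤ m * r := Nat.zero_le _
        nlinarith
      have h5 : (2 : ℕ) ^ (s + 2) = 2 ^ m * (2 ^ r * 2) := by
        rw [show s + 2 = m + (r + 1) by omega, pow_add, pow_succ]
      calc (s + 3) * Fintype.card V = (s + 3) * (c * 2 ^ m) := by rw [hV]
        _ < (m + 1) * (2 ^ r * 2) * (c * 2 ^ m) := Nat.mul_lt_mul_of_pos_right h4 (by positivity)
        _ = (m + 1) * c * 2 ^ (s + 2) := by rw [h5]; ring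
        _ ≤ _ := h3
  · rintro rfl
    by_contra hne
    obtain ⟨y, hy⟩ : ∃ y, y ∉ A₀ := by
      by_contra! h
      exact hne (eq_univ_of_forall h)
    -- If u + y ∈ A₀ with u ∈ A₁, then adding u gives y ∈ A₀. Disjointness contradicts |A₀| + |A₁| >
    -- |V|, the density hypothesis at s = 0.
    have hdisj : Disjoint A₀ (A₁.image (· + y)) := by
      rw [disjoint_left]
      intro x hx hx'
      obtain ⟨u, hu, rfl⟩ := mem_image.1 hx'
      have := hA u hu _ hx
      rw [← add_assoc, add_self_of_zmod_two, zero_add] at this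
      exact hy this
    have h2 := card_le_univ (A₀ ∪ A₁.image (· + y))
    rw [card_union_of_disjoint hdisj, card_image_of_injective _ (add_left_injective y)] at h2
    omega

end Compression

/-! ### Slicing by the first coordinate. -/

section Slice

variable {n : ℕ}

/-- The slice of a subset of `ℤ₂ⁿ⁺¹` at a given first coordinate. -/
def firstSlice (c : ZMod 2) (A : Finset (Fin (n + 1) → ZMod 2)) : Finset (Fin n → ZMod 2) :=
  {x | Fin.cons c x ∈ A}

theorem mem_firstSlice {c : ZMod 2} {A : Finset (Fin (n + 1) → ZMod 2)} {x : Fin n → ZMod 2} :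
    x ∈ firstSlice c A ↔ (Fin.cons c x : Fin (n + 1) → ZMod 2) ∈ A := by
  simp [firstSlice]

theorem card_firstSlice_add (A : Finset (Fin (n + 1) → ZMod 2)) :
    #(firstSlice 0 A) + #(firstSlice 1 A) = #A := by
  have h : ∀ c, #(firstSlice c A) = #{x ∈ A | x 0 = c} := fun c => by
    refine card_bij' (fun x _ => Fin.cons c x) (fun x _ => Fin.tail x) ?_ ?_ ?_ ?_
    · intro x hx
      simpa [mem_firstSlice] using hx
    · intro x hx
      obtain ⟨hx, rfl⟩ := mem_filter.1 hx
      rwa [mem_firstSlice, Fin.cons_self_tail]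
    · intro x hx
      simp
    · intro x hx
      obtain ⟨hx, rfl⟩ := mem_filter.1 hx
      simp
  rw [card_eq_sum_card_fiberwise (f := fun x : Fin (n + 1) → ZMod 2 => x 0) (t := univ)
    (fun _ _ => by simp),
    h, h]
  exact (Fin.sum_univ_two (fun c : Fin 2 => #{x ∈ A | x 0 = (c : ZMod 2)})).symm

theorem firstSlice_add_subset (c d : ZMod 2) (A B : Finset (Fin (n + 1) → ZMod 2)) :
    firstSlice c A + firstSlice d B ⊆ firstSlice (c + d) (A + B) := by
  rw [add_subset_iff]
  intro a ha b hb
  rw [mem_firstSlice] at *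
  have : (Fin.cons (c + d) (a + b) : Fin (n + 1) → ZMod 2) = Fin.cons c a + Fin.cons d b := by
    ext i
    refine Fin.cases ?_ (fun j => ?_) i <;> simp
  rw [this]
  exact add_mem_add ha hb

theorem span_eq_top_of_single_mem (A : Finset (Fin n → ZMod 2))
    (hA : ∀ i, Pi.single i 1 ∈ A) : Submodule.span (ZMod 2) (A : Set (Fin n → ZMod 2)) = ⊤ := by
  rw [eq_top_iff, ← (Pi.basisFun (ZMod 2) (Fin n)).span_eq]
  refine Submodule.span_mono ?_
  rintro _ ⟨i, rfl⟩
  simpa using hA i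

end Slice

/-! ### The induction on `s`. -/

theorem ballProfile_step {s N : ℕ} (hN : 0 < N) {b₀ b₁ c₀ c₁ : ℕ} (hb : b₁ ≤ b₀)
    (hbN : b₀ ≤ N) (hc : b₀ ≤ c₁)
    (h0 : ballProfile s (2 ^ s * b₀ / N) ≤ 2 ^ s * c₀ / N)
    (h1 : b₁ ≠ 0 → ballProfile s (2 ^ s * b₁ / N) ≤ 2 ^ s * c₁ / N) :
    ballProfile (s + 1) (2 ^ (s + 1) * ((b₀ + b₁ : ℕ) : ℝ) / (2 * N)) ≤
      2 ^ (s + 1) * ((c₀ + c₁ : ℕ) : ℝ) / (2 * N) := by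
  have hN' : (0 : ℝ) < N := by exact_mod_cast hN
  have key := ballProfile_succ_add_le s (x₀ := 2 ^ s * b₀ / N) (x₁ := 2 ^ s * b₁ / N)
    (y₀ := 2 ^ s * c₀ / N) (y₁ := 2 ^ s * c₁ / N) (by positivity) (by gcongr) ?_ h0 (by gcongr) ?_
  · convert key using 2 <;> (push_cast; field_simp; ring)
  · rw [div_le_iff₀ hN']
    have : (b₀ : ℝ) ≤ N := by exact_mod_cast hbN
    gcongr
  · intro h
    refine h1 fun h' => h ?_
    simp [h']

/-- At s = 0 the bound says A + B is everything, which density above 3/4 alone does not force; hence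
the extra hypothesis there. -/
theorem ballProfile_le_card_add (s : ℕ) : ∀ (n : ℕ) (A B : Finset (Fin n → ZMod 2)), 0 ∈ A →
    (∀ i, Pi.single i 1 ∈ A) → B.Nonempty → (s + 3) * 2 ^ n < #A * 2 ^ (s + 2) →
    (s = 0 → A = univ) →
    ballProfile s (2 ^ s * #B / (2 ^ n : ℕ)) ≤ 2 ^ s * #(A + B) / (2 ^ n : ℕ) := by
  have huniv : ∀ (s n : ℕ) (A B : Finset (Fin n → ZMod 2)), A + B = univ →
      ballProfile s (2 ^ s * #B / (2 ^ n : ℕ)) ≤ 2 ^ s * #(A + B) / (2 ^ n : ℕ) := by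
    intro s n A B h
    refine (ballProfile_le_two_pow _ _).trans_eq ?_
    rw [h, card_univ, Fintype.card_fun, ZMod.card, Fintype.card_fin]
    field_simp
  induction s with
  | zero =>
    intro n A B _ _ hB _ hA
    refine huniv 0 n A B ?_
    rw [hA rfl]
    obtain ⟨b, hb⟩ := hB
    exact eq_univ_of_forall fun x => mem_add.2 ⟨x - b, mem_univ _, b, hb, sub_add_cancel _ _⟩
  | succ s ih =>
    intro n A B h0 he hB hA _
    cases n with
    | zero =>
      refine huniv _ _ A B (eq_univ_of_forall fun x => ?_)
      obtain ⟨b, hb⟩ := hB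
      exact mem_add.2 ⟨0, h0, b, hb, Subsingleton.elim _ _⟩
    | succ n =>
      obtain ⟨A₀, A₁, B₀, B₁, C₀, C₁, hsub, h1, hAc, hBc, hCc, h00, h11, h01, h10, hstab⟩ :=
        exists_compressed (firstSlice 0 A) (firstSlice 1 A) (firstSlice 0 B) (firstSlice 1 B)
          (firstSlice 0 (A + B)) (firstSlice 1 (A + B))
          (by
            rw [mem_firstSlice]
            convert he 0 using 1
            ext i
            refine Fin.cases ?_ (fun j => ?_) i <;> simp)
          (firstSlice_add_subset 0 0 A B) (firstSlice_add_subset 1 1 A B)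
          (firstSlice_add_subset 0 1 A B) (firstSlice_add_subset 1 0 A B)
      rw [card_firstSlice_add] at hAc hBc hCc
      have h0' : 0 ∈ A₀ := hsub <| by
        rw [mem_firstSlice]
        convert h0 using 1
        ext i
        refine Fin.cases ?_ (fun j => ?_) i <;> simp
      have he' : ∀ i, Pi.single i 1 ∈ A₀ := fun i => hsub <| by
        rw [mem_firstSlice]
        convert he i.succ using 1
        ext j
        refine Fin.cases ?_ (fun j => ?_) j <;> simp [Pi.single_apply]
      have hV : Fintype.card (Fin n → ZMod 2) = 2 ^ n := by simp
      obtain ⟨hlt, huniv'⟩ := card_lower_half_lt s A₀ A₁ h0'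
        (span_eq_top_of_single_mem A₀ he') hstab (by
          rw [hV, hAc, ← pow_succ']
          exact hA)
      rw [hV] at hlt
      have hI := fun (B' : Finset (Fin n → ZMod 2)) (hB' : B'.Nonempty) (C : Finset (Fin n → ZMod 2))
          (hC : A₀ + B' ⊆ C) => (ih n A₀ B' h0' he' hB' hlt huniv').trans
            (show (2 : ℝ) ^ s * #(A₀ + B') / (2 ^ n : ℕ) ≤ 2 ^ s * #C / (2 ^ n : ℕ) by
              have := card_le_card hC
              gcongr)
      have hsum : ∀ (D E : Finset (Fin n → ZMod 2)), A₁ + D ⊆ E → #D ≤ #E := fun D E h =>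
        card_le_card fun x hx => h (by simpa using add_mem_add h1 hx)
      have hpos : 0 < #B := card_pos.2 hB
      have hN : ((2 ^ (n + 1) : ℕ) : ℝ) = 2 * (2 ^ n : ℕ) := by push_cast; ring
      rw [hN, ← hBc]
      have hcard : ∀ D : Finset (Fin n → ZMod 2), #D ≤ 2 ^ n := fun D =>
        (card_le_univ D).trans_eq hV
      have hgoal : ballProfile (s + 1)
          (2 ^ (s + 1) * ((#B₀ + #B₁ : ℕ) : ℝ) / (2 * (2 ^ n : ℕ))) ≤
          2 ^ (s + 1) * ((#C₀ + #C₁ : ℕ) : ℝ) / (2 * (2 ^ n : ℕ)) := by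
        -- The step needs the larger half of B first; exchanging the halves of B exchanges those of
        -- C.
        rcases le_total #B₁ #B₀ with h | h
        · refine ballProfile_step (by positivity) h (hcard _) (hsum _ _ h10)
            (hI _ (card_pos.1 (by omega)) _ h00) fun h' =>
              hI _ (card_pos.1 (Nat.pos_of_ne_zero h')) _ h01
        · rw [add_comm #B₀, add_comm #C₀]
          refine ballProfile_step (by positivity) h (hcard _) (hsum _ _ h11)
            (hI _ (card_pos.1 (by omega)) _ h01) fun h' =>
              hI _ (card_pos.1 (Nat.pos_of_ne_zero h')) _ h00
      rwa [hCc] at hgoal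

/-! ### Reduction to sets containing 0 and the standard basis. -/

section Transport

variable {n : ℕ}

theorem exists_linearEquiv_single_mem (A : Finset (Fin n → ZMod 2))
    (hA : Submodule.span (ZMod 2) (A : Set (Fin n → ZMod 2)) = ⊤) :
    ∃ φ : (Fin n → ZMod 2) ≃ₗ[ZMod 2] (Fin n → ZMod 2), ∀ i, Pi.single i 1 ∈ A.image φ := by
  classical
  let b := Module.Basis.ofSpan hA.ge
  have : Fintype _ := Module.Basis.fintypeIndexOfRankLtAleph0 b (Module.rank_lt_aleph0 _ _)
  have hc := Module.finrank_eq_card_basis b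
  rw [Module.finrank_fin_fun] at hc
  let b' := b.reindex (Fintype.equivFinOfCardEq hc.symm)
  refine ⟨b'.equivFun, fun i => mem_image.2 ⟨b' i, ?_, ?_⟩⟩
  swap
  · ext j
    rw [b'.equivFun_self, Pi.single_apply, eq_comm]
    simp [eq_comm]
  have : b' i ∈ Set.range b := by
    rw [Module.Basis.reindex_apply]
    exact Set.mem_range_self _
  exact_mod_cast Module.Basis.ofSpan_subset hA.ge this

theorem affineSpan_eq_top_iff_span_eq_top {S : Set (Fin n → ZMod 2)} (h0 : 0 ∈ S) :
    affineSpan (ZMod 2) S = ⊤ ↔ Submodule.span (ZMod 2) S = ⊤ := by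
  rw [AffineSubspace.affineSpan_eq_top_iff_vectorSpan_eq_top_of_nonempty _ _ _ ⟨0, h0⟩,
    vectorSpan_eq_span_vsub_set_right _ h0]
  simp

theorem ballProfile_le_card_add_of_affineSpan {s : ℕ} (hs : s ≠ 0)
    (A B : Finset (Fin n → ZMod 2))
    (hA : affineSpan (ZMod 2) (A : Set (Fin n → ZMod 2)) = ⊤) (hB : B.Nonempty)
    (hcard : (s + 3) * 2 ^ n < #A * 2 ^ (s + 2)) :
    ballProfile s (2 ^ s * #B / (2 ^ n : ℕ)) ≤ 2 ^ s * #(A + B) / (2 ^ n : ℕ) := by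
  obtain ⟨a, ha⟩ : A.Nonempty := card_pos.1 (by
    by_contra! h
    rw [Nat.le_zero.1 h] at hcard
    omega)
  have h0 : 0 ∈ -a +ᵥ A := mem_vadd_finset.2 ⟨a, ha, by simp⟩
  have hspan : Submodule.span (ZMod 2) ((-a +ᵥ A : Finset _) : Set (Fin n → ZMod 2)) = ⊤ := by
    rw [AffineSubspace.affineSpan_eq_top_iff_vectorSpan_eq_top_of_nonempty _ _ _ ⟨a, ha⟩,
      vectorSpan_eq_span_vsub_set_right _ (mem_coe.2 ha)] at hA
    have e : ((-a +ᵥ A : Finset _) : Set (Fin n → ZMod 2)) = (· -ᵥ a) '' (A : Set _) := by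
      rw [coe_vadd_finset]
      exact Set.image_congr fun x _ => by simp [sub_eq_neg_add]
    rwa [e]
  obtain ⟨φ, hφ⟩ := exists_linearEquiv_single_mem _ hspan
  have key := ballProfile_le_card_add s n ((-a +ᵥ A).image φ) (B.image φ)
    (mem_image.2 ⟨0, h0, map_zero φ⟩) hφ (hB.image _)
    (by rwa [card_image_of_injective _ φ.injective, card_vadd_finset]) (fun h => absurd h hs)
  rwa [← image_add, card_image_of_injective _ φ.injective, card_image_of_injective _ φ.injective,
    vadd_add_assoc, card_vadd_finset] at key

end Transport

/-! ### From the profile to the stated bound. -/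

theorem succ_mul_two_pow_lt {s t : ℕ} (ht : 0 < t) (h : t < s) :
    (s + 1) * 2 ^ t < (t + 1) * 2 ^ s := by
  obtain ⟨r, rfl⟩ := Nat.exists_eq_add_of_lt h
  have h2 : r + 1 ≤ 2 ^ r := Nat.lt_two_pow_self
  have h3 : t + r + 1 + 1 < (t + 1) * (2 ^ r * 2) := by
    have : (t + 1) * ((r + 1) * 2) ≤ (t + 1) * (2 ^ r * 2) := by gcongr
    nlinarith [Nat.zero_le (t * r)]
  calc _ < (t + 1) * (2 ^ r * 2) * 2 ^ t := Nat.mul_lt_mul_of_pos_right h3 (by positivity)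
    _ = _ := by rw [add_assoc t r 1, pow_add, pow_succ]; ring

theorem card_add_lower_bound {n : ℕ} (A B : Finset (Fin n → ZMod 2))
    (hA : affineSpan (ZMod 2) (A : Set (Fin n → ZMod 2)) = ⊤) (hB : B.Nonempty)
    (hcard : (#A : ℝ) ≤ 3 / 4 * (Fintype.card (Fin n → ZMod 2) : ℝ)) (t : ℕ)
    (ht : IsGreatest {s : ℕ | 0 < s ∧
      (#A : ℝ) ≤ ((s : ℝ) + 1) / 2 ^ s * (Fintype.card (Fin n → ZMod 2) : ℝ)} t)
    (k : ℕ) (hk : k < t) (w : ℝ) (hw : w ∈ Set.Icc (-1 : ℝ) 1)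
    (hBcard : (#B : ℝ) =
      ((∑ i ∈ range (k + 1), (t.choose i : ℝ)) + w * ((t - 1).choose k : ℝ)) / 2 ^ t
        * (Fintype.card (Fin n → ZMod 2) : ℝ)) :
    ((∑ i ∈ range (k + 2), (t.choose i : ℝ)) + w * ((t - 1).choose (k + 1) : ℝ)) / 2 ^ t
      * (Fintype.card (Fin n → ZMod 2) : ℝ) ≤ (#(A + B) : ℝ) := by
  -- 3/4 is (s+1)/2^s at s = 2; this makes t - 1 nonzero.
  have ht2 : 2 ≤ t := ht.2 ⟨two_pos, hcard.trans_eq (by norm_num)⟩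
  obtain ⟨s, rfl⟩ : ∃ s, t = s + 1 := ⟨t - 1, by omega⟩
  have hV : Fintype.card (Fin n → ZMod 2) = 2 ^ n := by simp
  rw [hV] at hcard hBcard ⊢
  simp only [hV] at ht
  -- Maximality of t = s+1, read as failure of the inequality at s+2.
  have hlt : (s + 3) * 2 ^ n < #A * 2 ^ (s + 2) := by
    by_contra! h
    have : s + 2 ≤ s + 1 := ht.2 ⟨by omega, by
      rw [div_mul_eq_mul_div, le_div_iff₀ (by positivity)]
      have h' : ((#A * 2 ^ (s + 2) : ℕ) : ℝ) ≤ (((s + 3) * 2 ^ n : ℕ) : ℝ) := by exact_mod_cast h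
      refine (le_of_eq ?_).trans (h'.trans_eq ?_) <;> (push_cast; ring)⟩
    omega
  have key := ballProfile_le_card_add_of_affineSpan (by omega) A B hA hB hlt
  have e : ∀ k, ∑ i ∈ range (k + 1), ((s + 1).choose i : ℝ) =
    binomSum s (k + 1) + binomSum s k := binomSum_succ_succ s
  rw [e, Nat.add_sub_cancel] at hBcard ⊢
  have hn : (0 : ℝ) < (2 ^ n : ℕ) := by positivity
  -- w ∈ [-1, 1] becomes the interpolation parameter (1+w)/2 ∈ [0, 1] in dimension t - 1.
  have hx : (2 : ℝ) ^ s * #B / (2 ^ n : ℕ) = binomSum s k + (1 + w) / 2 * s.choose k := by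
    rw [hBcard, binomSum_succ]
    field_simp
    ring
  rw [hx, ballProfile_eq _ _ (by linarith [hw.1]) (by linarith [hw.2]), le_div_iff₀ hn] at key
  have hs : (0 : ℝ) < 2 ^ s := by positivity
  rw [div_mul_eq_mul_div, div_le_iff₀ (by positivity), pow_succ, binomSum_succ s (k + 1)]
  linarith

/-! ### Hamming balls attain equality. -/

section Tightness

theorem card_hammingBall (t k : ℕ) : #(hammingBall t k) = ∑ i ∈ range (k + 1), t.choose i := by
  rw [hammingBall, card_eq_sum_card_fiberwise
    (f := fun x : Fin t → ZMod 2 => #{i | x i = 1}) (t := range (k + 1))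
    (fun x hx => by simpa [Nat.lt_succ_iff] using hx)]
  refine sum_congr rfl fun j hj => ?_
  rw [show t.choose j = #(powersetCard j (univ : Finset (Fin t))) by simp]
  refine card_bij' (fun x _ => ({i | x i = 1} : Finset (Fin t)))
    (fun S _ i => if i ∈ S then 1 else 0) ?_ ?_ ?_ ?_
  · intro x hx
    simpa using (mem_filter.1 hx).2
  · intro S hS
    have : #S = j := by simpa using hS
    have hj' : j ≤ k := by simpa [Nat.lt_succ_iff] using hj
    simp [this, hj']
  · intro x _
    ext i
    have : ∀ c : ZMod 2, (if c = 1 then (1 : ZMod 2) else 0) = c := by decide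
    simpa using this (x i)
  · intro S _
    ext i
    simp

variable {n t : ℕ} (h : t ≤ n)

theorem mem_hammingBallProd {k : ℕ} {x : Fin n → ZMod 2} :
    x ∈ hammingBallProd h k ↔ #{i : Fin t | x (Fin.castLE h i) = 1} ≤ k := by
  simp [hammingBallProd, hammingBall]

theorem card_hammingBallProd (k : ℕ) :
    #(hammingBallProd h k) * 2 ^ t = (∑ i ∈ range (k + 1), t.choose i) * 2 ^ n := by
  obtain ⟨m, rfl⟩ := Nat.exists_eq_add_of_le h
  have : #(hammingBall t k ×ˢ (univ : Finset (Fin m → ZMod 2))) = #(hammingBallProd h k) := by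
    refine card_equiv (Fin.appendEquiv t m) fun p => ?_
    simp [hammingBallProd, Fin.appendEquiv]
  rw [← this, card_product, card_hammingBall, card_univ, Fintype.card_fun, ZMod.card,
    Fintype.card_fin, pow_add]
  ring

theorem cast_card_hammingBallProd (k : ℕ) :
    (#(hammingBallProd h k) : ℝ) = (∑ i ∈ range (k + 1), (t.choose i : ℝ)) / 2 ^ t
      * (Fintype.card (Fin n → ZMod 2) : ℝ) := by
  rw [div_mul_eq_mul_div, eq_div_iff (by positivity), Fintype.card_fun, ZMod.card,
    Fintype.card_fin]
  exact_mod_cast card_hammingBallProd h k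

theorem zero_mem_hammingBallProd (k : ℕ) : 0 ∈ hammingBallProd h k := by
  simp [mem_hammingBallProd]

theorem single_mem_hammingBallProd (i : Fin n) : Pi.single i 1 ∈ hammingBallProd h 1 := by
  rw [mem_hammingBallProd, card_le_one]
  intro a ha b hb
  simp only [mem_filter, mem_univ, true_and, Pi.single_apply, ite_eq_left_iff, zero_ne_one,
    imp_false, not_not] at ha hb
  exact Fin.castLE_injective h (ha.trans hb.symm)

/-- The support of a sum lies in the union of the supports; conversely, flipping one coordinate
equal to 1 lowers the weight by one. -/
theorem hammingBallProd_one_add (k : ℕ) :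
    hammingBallProd h 1 + hammingBallProd h k = hammingBallProd h (k + 1) := by
  have hz : ∀ a b : ZMod 2, a + b = 1 → a = 1 ∨ b = 1 := by decide
  ext x
  rw [mem_add]
  constructor
  · rintro ⟨a, ha, b, hb, rfl⟩
    rw [mem_hammingBallProd] at *
    calc _ ≤ #(({i : Fin t | a (Fin.castLE h i) = 1} : Finset (Fin t)) ∪
          ({i : Fin t | b (Fin.castLE h i) = 1} : Finset (Fin t))) := card_le_card fun i hi => by
            simpa using hz _ _ (by simpa using hi)
      _ ≤ _ := (card_union_le _ _).trans (by omega)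
  · intro hx
    rw [mem_hammingBallProd] at hx
    rcases eq_empty_or_nonempty ({i : Fin t | x (Fin.castLE h i) = 1} : Finset (Fin t)) with
      he | ⟨i, hi⟩
    · refine ⟨0, zero_mem_hammingBallProd h 1, x, ?_, zero_add x⟩
      rw [mem_hammingBallProd, he]
      simp
    · refine ⟨Pi.single (Fin.castLE h i) 1, single_mem_hammingBallProd h _,
        Pi.single (Fin.castLE h i) 1 + x, ?_, ?_⟩
      · rw [mem_hammingBallProd]
        refine Nat.le_of_lt_succ (lt_of_lt_of_le (card_lt_card ?_) hx)
        have hxi : x (Fin.castLE h i) = 1 := by simpa using hi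
        refine (ssubset_iff_of_subset fun j hj => ?_).2 ⟨i, hi, ?_⟩
        · rcases eq_or_ne j i with rfl | hne
          · exact hi
          · simpa [Pi.single_apply, hne] using hj
        · simp only [mem_filter, mem_univ, true_and, Pi.add_apply, Pi.single_eq_same, hxi]
          decide
      · rw [← add_assoc, add_self_of_zmod_two, zero_add]

theorem isGreatest_card_hammingBallProd_one (ht : 2 ≤ t) :
    IsGreatest {s : ℕ | 0 < s ∧ (#(hammingBallProd h 1) : ℝ) ≤
      ((s : ℝ) + 1) / 2 ^ s * (Fintype.card (Fin n → ZMod 2) : ℝ)} t := by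
  have hc : (#(hammingBallProd h 1) : ℝ) =
      ((t : ℝ) + 1) / 2 ^ t * (Fintype.card (Fin n → ZMod 2) : ℝ) := by
    rw [cast_card_hammingBallProd]
    simp [sum_range_succ, add_comm]
  refine ⟨⟨by omega, hc.le⟩, fun s hs => ?_⟩
  by_contra! hlt
  have h1 := hs.2
  rw [hc] at h1
  have h2 := le_of_mul_le_mul_right h1 (by exact_mod_cast Fintype.card_pos)
  rw [div_le_div_iff₀ (by positivity) (by positivity)] at h2
  exact absurd (succ_mul_two_pow_lt (by omega) hlt) (not_lt.2 (by exact_mod_cast h2))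

theorem card_hammingBallProd_one_le (ht : 2 ≤ t) :
    (#(hammingBallProd h 1) : ℝ) ≤ 3 / 4 * (Fintype.card (Fin n → ZMod 2) : ℝ) := by
  rw [cast_card_hammingBallProd]
  refine mul_le_mul_of_nonneg_right ?_ (Nat.cast_nonneg _)
  rw [div_le_div_iff₀ (by positivity) (by norm_num)]
  have : (t + 1) * 2 ^ 2 ≤ (2 + 1) * 2 ^ t := by
    rcases ht.eq_or_lt with rfl | h2
    · rfl
    · exact (succ_mul_two_pow_lt two_pos h2).le
  have : ((t : ℝ) + 1) * 2 ^ 2 ≤ (2 + 1) * 2 ^ t := by exact_mod_cast this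
  simp only [sum_range_succ, range_zero, sum_empty, Nat.choose_zero_right, Nat.choose_one_right,
    Nat.cast_one]
  linarith

end Tightness

theorem theorem1 (n : ℕ) :
    -- the lower bound
    (∀ A B : Finset (Fin n → ZMod 2),
      affineSpan (ZMod 2) (A : Set (Fin n → ZMod 2)) = ⊤ →
      B.Nonempty →
      (#A : ℝ) ≤ 3 / 4 * (Fintype.card (Fin n → ZMod 2) : ℝ) →
      ∀ t : ℕ,
        IsGreatest {s : ℕ | 0 < s ∧
          (#A : ℝ) ≤ ((s : ℝ) + 1) / 2 ^ s * (Fintype.card (Fin n → ZMod 2) : ℝ)} t →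
      ∀ k : ℕ, k < t →
      ∀ w : ℝ, w ∈ Set.Icc (-1 : ℝ) 1 →
        (#B : ℝ) = ((∑ i ∈ range (k + 1), (t.choose i : ℝ)) + w * ((t - 1).choose k : ℝ)) / 2 ^ t
          * (Fintype.card (Fin n → ZMod 2) : ℝ) →
        ((∑ i ∈ range (k + 2), (t.choose i : ℝ)) + w * ((t - 1).choose (k + 1) : ℝ)) / 2 ^ t
          * (Fintype.card (Fin n → ZMod 2) : ℝ) ≤ (#(A + B) : ℝ)) ∧
    -- tightness at `w = 0`: the products of balls satisfy all the hypotheses, with equality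
    (∀ (t k : ℕ) (htn : t ≤ n), 2 ≤ t → k < t →
      affineSpan (ZMod 2) (hammingBallProd htn 1 : Set (Fin n → ZMod 2)) = ⊤ ∧
      (hammingBallProd htn k).Nonempty ∧
      (#(hammingBallProd htn 1) : ℝ) ≤ 3 / 4 * (Fintype.card (Fin n → ZMod 2) : ℝ) ∧
      IsGreatest {s : ℕ | 0 < s ∧ (#(hammingBallProd htn 1) : ℝ) ≤
        ((s : ℝ) + 1) / 2 ^ s * (Fintype.card (Fin n → ZMod 2) : ℝ)} t ∧
      (#(hammingBallProd htn k) : ℝ) =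
        (∑ i ∈ range (k + 1), (t.choose i : ℝ)) / 2 ^ t
          * (Fintype.card (Fin n → ZMod 2) : ℝ) ∧
      hammingBallProd htn 1 + hammingBallProd htn k = hammingBallProd htn (k + 1) ∧
      (#(hammingBallProd htn 1 + hammingBallProd htn k) : ℝ) =
        (∑ i ∈ range (k + 2), (t.choose i : ℝ)) / 2 ^ t
          * (Fintype.card (Fin n → ZMod 2) : ℝ)) := by

  refine ⟨card_add_lower_bound, fun t k htn ht _ => ?_⟩
  refine ⟨?_, ⟨0, zero_mem_hammingBallProd htn k⟩, card_hammingBallProd_one_le htn ht,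
    isGreatest_card_hammingBallProd_one htn ht, cast_card_hammingBallProd htn k,
    hammingBallProd_one_add htn k, ?_⟩
  · rw [affineSpan_eq_top_iff_span_eq_top (zero_mem_hammingBallProd htn 1)]
    exact span_eq_top_of_single_mem _ (single_mem_hammingBallProd htn)
  · rw [hammingBallProd_one_add, cast_card_hammingBallProd]
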